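/- **Setting.** For $N\ge 0$ let $T_N$ be the finite tree of dyadic intervals $[i2^{-a},(i+1)2^{-a}]\subseteq[0,1]$, $0\le a\le N$, and let $T_N^2=T_N\times T_N$ be the bi-tree of dyadic rectangles, ordered by inclusion, with root $o=[0,1]^2$. For $f:T_N^2\to\mathbb R$ put $\mathbb If(R)=\sum_{R'\supseteq R}f(R')$ and $\mathbb I^*f(R)=\sum_{R'\subseteq R}f(R')$. Call $g$ superadditive in each variable if for all dyadic intervals $I,J$ the value $g(I\times J)$ is at least the sum of the values of $g$ at the two halves of $I \times J$ obtained by halving $I$ (when $I$ is not a leaf), and likewise for $J$. For $E\subseteq T_N^2$ let $\mathrm{cap}(E)=\inf\{\sum_R f(R)^2: f\ge0,\ \mathbb If\ge1\text{ on }E\}$. For a function $h$ and a constant $C$, let $\mathrm{SEM}(h,C)$ be the statement: for every $N$, all $f,g:T_N^2\to[0,\infty)$ with $g$ superadditive in each variable, and all $\delta>0$ and $\lambda\ge10\delta$ with $\operatorname{supp}f\subseteq\{\mathbb Ig\le\delta\}$, there is $\varphi:T_N^2\to[0,\infty)$ with $$\text{(1) } \mathbb I\varphi\ge\mathbb If\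 \text{ on }\{2\lambda\le\mathbb Ig\le4\lambda\},\qquad \text{(2) } \sum\varphi^2\le C\,h(\delta/\lambda)\sum f^2 .$$ The small energy majorization conjecture on the bi-tree says that $\mathrm{SEM}(h,C)$ holds with $h(t)=t$ for some $C$. **Construction.** Logarithms are to base $2$. For $s\in\mathbb N$ let $\log n=2^s$, i.e. $n=2^{2^s}$, and $2^M=n/\log n$. For $0\le j<2^M$ let $Q_j=[j2^{-M},(j+1)2^{-M}]^2$, and let $\omega_j$ be the dyadic square of side $2^{-n-M}$ in the south-west corner of $Q_j$. For $N\ge n+M$ let $\nu$ be the measure with mass $1/n^2$ at each $\omega_j$, let $g=\mathbb I^*\nu$, let $f=\mathbb I^*\delta_o$, where $\delta_o$ is the unit mass at the root, and let $\delta=\frac1{n\log n}$. Let $q_{jk}$ be the dyadic rectangle with the same south-west corner as $Q_j$ and with side lengths $2^{-M}2^{-n/2^k}$ (horizontal) and $2^{-M}2^{-2^k}$ (vertical), and let $$F=\{q_{jk}:0\le j<2^M,\ \tfrac12\log n\le k\le\tfrac34\log n\}.$$ **Theorem.** There are absolute constants $c,c_0>0$ and $s_0$ such that, with $\lambda=c/n$: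 (a) For all $s\ge s_0$ and all $N\ge n+M$: $f(o)=1$, $f(R)=0$ for $R\ne o$, and $\mathbb If\equiv1$; $g\ge 0$ is superadditive in each variable and $g(o)=\|\nu\|=\delta$; $\operatorname{supp}f\subseteq\{\mathbb Ig\le\delta\}$; $\lambda\ge10\delta$; $$F\subseteq\{2\lambda\le\mathbb Ig\le4\lambda\};\qquad c_0\le\mathrm{cap}(F)\le1;$$ whereas, for any $C$, the existence of $\varphi\ge0$ satisfying (1) and (2) with $h(t)=t$ for these $f,g,\delta,\lambda$ would force $\mathrm{cap}(F)\le\frac{C/c}{\log n}$. (b) For every $h$ with $h(t)\to0$ as $t\to0^+$ and every $C$ there is $s_1$ such that for all $s\ge s_1$ and all $N\ge n+M$ no $\varphi\ge0$ satisfies (1) and (2) for these $f,g,\delta,\lambda$. Consequently the conjecture is false: $\mathrm{SEM}(h,C)$ fails for every $C$ when $h(t)=t$, also when $h(t)=t^\varepsilon$ with any $\varepsilon>0$, and for every $h$ with $h(t)\to0$ as $t\to0^+$. -/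

import Mathlib

open Filter Topology

noncomputable section

namespace DyadicBiTree

/-- Vertices of the finite dyadic tree `T` of depth `N`: the dyadic interval
`[index / 2 ^ level, (index + 1) / 2 ^ level] ⊆ [0, 1]` with `level ≤ N`. -/
@[ext]
structure Tree (N : ℕ) where
  level : ℕ
  index : ℕ
  level_le : level ≤ N
  index_lt : index < 2 ^ level

namespace Tree

variable {N : ℕ}

/-- The interval of the real line that corresponds to a vertex. -/
def toSet (I : Tree N) : Set ℝ :=
  Set.Icc ((I.index : ℝ) / 2 ^ I.level) (((I.index : ℝ) + 1) / 2 ^ I.level)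

/-- The order of the tree is inclusion of dyadic intervals. -/
instance : LE (Tree N) := ⟨fun I J => I.toSet ⊆ J.toSet⟩

/-- Inclusion in terms of generations and positions. -/
theorem le_iff (I J : Tree N) :
    I ≤ J ↔ J.level ≤ I.level ∧ I.index / 2 ^ (I.level - J.level) = J.index := by
  have hI : (0 : ℝ) < 2 ^ I.level := by positivity
  have hJ : (0 : ℝ) < 2 ^ J.level := by positivity
  have hle : ((I.index : ℝ) / 2 ^ I.level) ≤ (((I.index : ℝ) + 1) / 2 ^ I.level) := by
    gcongr; linarith
  have key : I ≤ J ↔ (J.index : ℝ) / 2 ^ J.level ≤ (I.index : ℝ) / 2 ^ I.level ∧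
      ((I.index : ℝ) + 1) / 2 ^ I.level ≤ ((J.index : ℝ) + 1) / 2 ^ J.level :=
    Set.Icc_subset_Icc_iff hle
  have aux : J.level ≤ I.level → ((J.index : ℝ) / 2 ^ J.level ≤ (I.index : ℝ) / 2 ^ I.level ∧
      ((I.index : ℝ) + 1) / 2 ^ I.level ≤ ((J.index : ℝ) + 1) / 2 ^ J.level ↔
      I.index / 2 ^ (I.level - J.level) = J.index) := by
    intro h
    obtain ⟨d, hd⟩ := Nat.exists_eq_add_of_le h
    have hd0 : (0 : ℕ) < 2 ^ d := by positivity
    rw [hd, Nat.add_sub_cancel_left, Nat.div_eq_iff hd0, pow_add,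
      div_le_div_iff₀ hJ (by positivity), div_le_div_iff₀ (by positivity) hJ]
    have e1 : (J.index : ℝ) * (2 ^ J.level * 2 ^ d) ≤ I.index * 2 ^ J.level ↔
        J.index * 2 ^ d ≤ I.index := by
      rw [show (J.index : ℝ) * (2 ^ J.level * 2 ^ d) = (J.index * 2 ^ d) * 2 ^ J.level by ring,
        mul_le_mul_iff_left₀ hJ]
      exact_mod_cast Iff.rfl
    have e2 : ((I.index : ℝ) + 1) * 2 ^ J.level ≤ (J.index + 1) * (2 ^ J.level * 2 ^ d) ↔
        I.index + 1 ≤ (J.index + 1) * 2 ^ d := by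
      rw [show ((J.index : ℝ) + 1) * (2 ^ J.level * 2 ^ d)
        = ((J.index + 1) * 2 ^ d) * 2 ^ J.level by ring, mul_le_mul_iff_left₀ hJ]
      exact_mod_cast Iff.rfl
    rw [e1, e2, Nat.add_mul, Nat.one_mul]
    omega
  rw [key]
  constructor
  · intro h
    have hl : J.level ≤ I.level := by
      have h1 : (1 : ℝ) / 2 ^ I.level ≤ 1 / 2 ^ J.level := by
        have := h.1
        have := h.2
        rw [add_div, add_div] at this
        linarith
      rw [div_le_div_iff₀ hI hJ, one_mul, one_mul] at h1
      exact (pow_le_pow_iff_right₀ (by norm_num)).1 h1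
    exact ⟨hl, (aux hl).1 h⟩
  · rintro ⟨hl, h⟩
    exact (aux hl).2 h

instance : Fintype (Tree N) :=
  Fintype.ofInjective
    (fun I : Tree N => ((⟨I.level, by have := I.level_le; omega⟩,
      ⟨I.index, lt_of_lt_of_le I.index_lt
        (Nat.pow_le_pow_right (by norm_num) I.level_le)⟩) : Fin (N + 1) × Fin (2 ^ N)))
    (fun I J h => by
      simp only [Prod.mk.injEq, Fin.mk.injEq] at h
      exact Tree.ext h.1 h.2)

/-- The root `[0, 1]`. -/
def root (N : ℕ) : Tree N := ⟨0, 0, Nat.zero_le N, by norm_num⟩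

/-- `I'` is one of the two halves of `I`. -/
def IsChild (I' I : Tree N) : Prop := I' ≤ I ∧ I'.level = I.level + 1

/-- `I` is the dyadic interval `[i / 2 ^ a, (i + 1) / 2 ^ a]`. -/
def Is (I : Tree N) (a i : ℕ) : Prop := I.level = a ∧ I.index = i

end Tree

/-- Vertices of the bi-tree `T²` of depth `N`: dyadic rectangles, ordered by inclusion
(the componentwise order of the product). -/
abbrev BiTree (N : ℕ) := Tree N × Tree N

/-- The root `[0, 1] × [0, 1]`. -/
def root (N : ℕ) : BiTree N := (Tree.root N, Tree.root N)

open Classical in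
/-- The Hardy operator: summation over all rectangles that contain `R`. -/
def hardy {N : ℕ} (f : BiTree N → ℝ) (R : BiTree N) : ℝ :=
  ∑ R' : BiTree N with R ≤ R', f R'

open Classical in
/-- The adjoint operator: summation over all rectangles contained in `R`. -/
def hardyAdj {N : ℕ} (f : BiTree N → ℝ) (R : BiTree N) : ℝ :=
  ∑ R' : BiTree N with R' ≤ R, f R'

open Classical in
/-- Superadditivity in each variable: the value at a rectangle is at least the sum of the values
at its two halves, for both ways of halving it. -/
def Superadditive {N : ℕ} (g : BiTree N → ℝ) : Prop :=
  (∀ I J : Tree N, ∑ I' : Tree N with Tree.IsChild I' I, g (I', J) ≤ g (I, J)) ∧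
  (∀ I J : Tree N, ∑ J' : Tree N with Tree.IsChild J' J, g (I, J') ≤ g (I, J))

/-- The capacity of a set `E` of vertices. -/
def capacity {N : ℕ} (E : Set (BiTree N)) : ℝ :=
  sInf {x : ℝ | ∃ f : BiTree N → ℝ, (∀ R, 0 ≤ f R) ∧ (∀ R ∈ E, 1 ≤ hardy f R) ∧
    x = ∑ R : BiTree N, f R ^ 2}

/-- `φ ≥ 0` majorizes: `𝕀 φ ≥ 𝕀 f` on `{2 lam ≤ 𝕀 g ≤ 4 lam}` and `∫ φ² ≤ B ∫ f²`. -/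
def IsMajorant {N : ℕ} (f g : BiTree N → ℝ) (lam B : ℝ) (φ : BiTree N → ℝ) : Prop :=
  (∀ R, 0 ≤ φ R) ∧
  (∀ R, 2 * lam ≤ hardy g R → hardy g R ≤ 4 * lam → hardy f R ≤ hardy φ R) ∧
  ∑ R : BiTree N, φ R ^ 2 ≤ B * ∑ R : BiTree N, f R ^ 2

/-- Small energy majorization on bi-trees of all finite depths, with the factor
`C * h (δ / lam)`. -/
def SmallEnergyMajorization (h : ℝ → ℝ) (C : ℝ) : Prop :=
  ∀ (N : ℕ) (f g : BiTree N → ℝ), (∀ R, 0 ≤ f R) → (∀ R, 0 ≤ g R) → Superadditive g →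
    ∀ δ lam : ℝ, 0 < δ → (∀ R, f R ≠ 0 → hardy g R ≤ δ) → 10 * δ ≤ lam →
      ∃ φ : BiTree N → ℝ, IsMajorant f g lam (C * h (δ / lam)) φ

/-! The construction, with parameter `s`. Logarithms are to base `2`. -/

/-- `log n = 2 ^ s`. -/
def logn (s : ℕ) : ℕ := 2 ^ s

/-- `n`. -/
def nn (s : ℕ) : ℕ := 2 ^ logn s

/-- `M = log (n / log n)`, so that `2 ^ M = n / log n`. -/
def MM (s : ℕ) : ℕ := logn s - s

/-- `δ = 1 / (n log n)`. -/
def delta (s : ℕ) : ℝ := 1 / ((nn s : ℝ) * logn s)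

open Classical in
/-- The unit mass at the root. -/
def rootMass (N : ℕ) (R : BiTree N) : ℝ := if R = root N then 1 else 0

/-- `R` is the square `ω_j` of side `2 ^ (-n - M)` in the south-west corner of the diagonal
square `Q_j = [j / 2 ^ M, (j + 1) / 2 ^ M]²`, `0 ≤ j < 2 ^ M`. -/
def IsOmega (s : ℕ) {N : ℕ} (j : ℕ) (R : BiTree N) : Prop :=
  R.1.Is (MM s + nn s) (j * 2 ^ nn s) ∧ R.2.Is (MM s + nn s) (j * 2 ^ nn s)

open Classical in
/-- The measure `ν`: mass `1 / n²` at each `ω_j`. -/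
def nu (s N : ℕ) (R : BiTree N) : ℝ :=
  if ∃ j < 2 ^ MM s, IsOmega s j R then 1 / (nn s : ℝ) ^ 2 else 0

/-- `R` is the rectangle `q_{jk}` with sides `2 ^ (-M - n / 2 ^ k)` and `2 ^ (-M - 2 ^ k)` in the
south-west corner of `Q_j`. -/
def IsQ (s : ℕ) {N : ℕ} (j k : ℕ) (R : BiTree N) : Prop :=
  R.1.Is (MM s + nn s / 2 ^ k) (j * 2 ^ (nn s / 2 ^ k)) ∧
  R.2.Is (MM s + 2 ^ k) (j * 2 ^ (2 ^ k))

/-- The set of all `q_{jk}` with `0 ≤ j < n / log n` and `(log n) / 2 ≤ k ≤ 3 (log n) / 4`. -/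
def setF (s N : ℕ) : Set (BiTree N) :=
  {R | ∃ j k : ℕ, j < 2 ^ MM s ∧ logn s ≤ 2 * k ∧ 4 * k ≤ 3 * logn s ∧ IsQ s j k R}

/-- `f = 𝕀* (unit mass at the root)`. -/
def fEx (N : ℕ) : BiTree N → ℝ := hardyAdj (rootMass N)

/-- `g = 𝕀* ν`. -/
def gEx (s N : ℕ) : BiTree N → ℝ := hardyAdj (nu s N)

end DyadicBiTree

end

open DyadicBiTree

namespace DyadicBiTree

/-! Since `𝕀 f ≡ 1`, a majorant `φ` is a test function for the capacity of any subset of the level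
set, so once `F` lies in that set, `cap F ≤ C h(δ/λ)`. Here `δ/λ = 2/log n → 0`, so it suffices that
`cap F` stays bounded below.

Both estimates rest on one kernel: `𝕀𝕀*` counts common ancestors, and the count is a product over
the two coordinates (`card_common`, `hardy_hardyAdj`). Write `log n = 4t`, `k = 2t + u`, `0 ≤ u ≤
t`. Inside one `Q_j`, all `q_{jk}` have the same relative area `1/n`, so each has about `n` common
ancestors with `ω_j`. Two of them with parameters `u, v` have only about `n 2^(-|u-v|)`, which is
summable in `v`. Rectangles from different diagonal squares share only ancestors of generation below
`M` in each coordinate, and the squared counts sum over `j` to `O(2^M)` (`sum_agree_sq_le`).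

Hence `𝕀g` is between `1/n` and `2/n` on `F` (`hardy_gEx_bounds`), while the counting measure on the
`(t+1) 2^M` rectangles has energy at most `19` times its squared mass (`energy_rect_le`). Duality
(`sq_card_le_energy`) then gives `cap F ≥ 1/19`. -/

open Classical in
/-- The number of common ancestors of two vertices of the tree. -/
noncomputable def common {N : ℕ} (I J : Tree N) : ℕ :=
  (Finset.univ.filter fun K : Tree N => I ≤ K ∧ J ≤ K).card

/-- The number of generations `l < M` in which the positions `i, j < 2 ^ M` of generation `M`
have the same ancestor. -/
def agree (M i j : ℕ) : ℕ :=
  ((Finset.range M).filter fun l => i / 2 ^ (M - l) = j / 2 ^ (M - l)).card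

/-! ### Ancestors in the tree and corner intervals -/

namespace Tree

variable {N : ℕ}

theorem le_trans' {I J K : Tree N} (h₁ : I ≤ J) (h₂ : J ≤ K) : I ≤ K :=
  Set.Subset.trans (a := I.toSet) h₁ h₂

theorem le_refl' (I : Tree N) : I ≤ I := Set.Subset.refl I.toSet

theorem le_root (I : Tree N) : I ≤ root N := by
  rw [le_iff]
  exact ⟨Nat.zero_le _, by simpa [root] using Nat.div_eq_of_lt I.index_lt⟩

/-- A vertex has one ancestor per generation, so common ancestors can be counted by their levels. -/
theorem eq_of_le_of_level_eq {I J K : Tree N} (hJ : I ≤ J) (hK : I ≤ K)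
    (h : J.level = K.level) : J = K := by
  rw [le_iff] at hJ hK
  refine Tree.ext h ?_
  rw [← hJ.2, ← hK.2, h]

theorem eq_root_of_le {I : Tree N} (h : root N ≤ I) : I = root N := by
  refine eq_of_le_of_level_eq h (le_refl' _) ?_
  have := ((le_iff _ _).1 h).1
  simpa [root] using this

theorem exists_ancestor (I : Tree N) {l : ℕ} (hl : l ≤ I.level) :
    ∃ K : Tree N, I ≤ K ∧ K.level = l := by
  refine ⟨⟨l, I.index / 2 ^ (I.level - l), hl.trans I.level_le, ?_⟩, ?_, rfl⟩
  · rw [Nat.div_lt_iff_lt_mul (by positivity), ← pow_add, Nat.add_sub_cancel' hl]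
    exact I.index_lt
  · rw [le_iff]
    exact ⟨hl, rfl⟩

/-- The dyadic interval of generation `M + d` at the left end of the `j`-th interval of
generation `M`. -/
def corner (N M d j : ℕ) : Tree N :=
  if h : M + d ≤ N ∧ j < 2 ^ M then
    ⟨M + d, j * 2 ^ d, h.1, by
      rw [pow_add]; exact Nat.mul_lt_mul_of_pos_right h.2 (by positivity)⟩
  -- Junk value: `corner` is only used where `corner_is` applies.
  else root N

theorem corner_is {N M d j : ℕ} (h : M + d ≤ N) (hj : j < 2 ^ M) :
    (corner N M d j).Is (M + d) (j * 2 ^ d) := by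
  simp [corner, h, hj, Is]

theorem Is.eq {I J : Tree N} {a i : ℕ} (hI : I.Is a i) (hJ : J.Is a i) : I = J :=
  Tree.ext (hI.1.trans hJ.1.symm) (hI.2.trans hJ.2.symm)

theorem Is.le {M d e j : ℕ} {I J : Tree N} (hI : I.Is (M + d) (j * 2 ^ d))
    (hJ : J.Is (M + e) (j * 2 ^ e)) (h : d ≤ e) : J ≤ I := by
  rw [le_iff, hI.1, hI.2, hJ.1, hJ.2]
  refine ⟨by omega, ?_⟩
  obtain ⟨r, rfl⟩ := Nat.exists_eq_add_of_le h
  rw [show M + (d + r) - (M + d) = r by omega, pow_add, ← mul_assoc,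
    Nat.mul_div_cancel _ (by positivity)]

end Tree

open DyadicBiTree.Tree

variable {N : ℕ}

/-! ### Counting common ancestors -/

theorem common_comm (I J : Tree N) : common I J = common J I := by
  unfold common
  congr 1
  ext K
  simp only [Finset.mem_filter]
  tauto

theorem common_le_left (I J : Tree N) : common I J ≤ I.level + 1 := by
  classical
  rw [← Finset.card_range (I.level + 1)]
  refine Finset.card_le_card_of_injOn Tree.level ?_ ?_
  · intro K hK
    simp only [Finset.coe_filter, Finset.mem_univ, true_and, Set.mem_ofPred_eq] at hK
    have := ((le_iff _ _).1 hK.1).1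
    simp only [Finset.coe_range, Set.mem_Iio]
    omega
  · intro K hK K' hK' h
    simp only [Finset.coe_filter, Finset.mem_univ, true_and, Set.mem_ofPred_eq] at hK hK'
    exact eq_of_le_of_level_eq hK.1 hK'.1 h

theorem common_le_right (I J : Tree N) : common I J ≤ J.level + 1 :=
  common_comm I J ▸ common_le_left J I

theorem level_lt_common {I J : Tree N} (h : J ≤ I) : I.level + 1 ≤ common I J := by
  classical
  rw [← Finset.card_range (I.level + 1)]
  refine Finset.card_le_card_of_surjOn Tree.level ?_
  intro l hl
  simp only [Finset.coe_range, Set.mem_Iio] at hl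
  obtain ⟨K, hK, rfl⟩ := I.exists_ancestor (Nat.lt_succ_iff.1 hl)
  exact ⟨K, by simpa using ⟨hK, le_trans' h hK⟩, rfl⟩

/-- A common ancestor of generation at least `M` would lie in both the `i`-th and the `j`-th
interval of generation `M`; hence all have generation below `M`. -/
theorem common_le_agree {M d e i j : ℕ} {I J : Tree N} (hI : I.Is (M + d) (i * 2 ^ d))
    (hJ : J.Is (M + e) (j * 2 ^ e)) (hij : i ≠ j) : common I J ≤ agree M i j := by
  classical
  refine Finset.card_le_card_of_injOn Tree.level ?_ ?_
  · intro K hK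
    simp only [Finset.coe_filter, Finset.mem_univ, true_and, Set.mem_ofPred_eq] at hK
    have hi := (le_iff _ _).1 hK.1
    have hj := (le_iff _ _).1 hK.2
    rw [hI.1, hI.2] at hi
    rw [hJ.1, hJ.2] at hj
    rcases lt_or_ge K.level M with h | h
    · simp only [Finset.coe_filter, Finset.mem_range, Set.mem_ofPred_eq]
      refine ⟨h, ?_⟩
      have hi2 := hi.2
      have hj2 := hj.2
      rw [show M + d - K.level = M - K.level + d by omega, pow_add,
        Nat.mul_div_mul_right _ _ (by positivity)] at hi2
      rw [show M + e - K.level = M - K.level + e by omega, pow_add,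
        Nat.mul_div_mul_right _ _ (by positivity)] at hj2
      rw [hi2, hj2]
    · exfalso
      obtain ⟨r, hr⟩ := Nat.exists_eq_add_of_le h
      rw [hr] at hi hj
      obtain ⟨d', rfl⟩ := Nat.exists_eq_add_of_le (show r ≤ d by omega)
      obtain ⟨e', rfl⟩ := Nat.exists_eq_add_of_le (show r ≤ e by omega)
      have hi2 := hi.2
      have hj2 := hj.2
      rw [show M + (r + d') - (M + r) = d' by omega, pow_add, ← mul_assoc,
        Nat.mul_div_cancel _ (by positivity)] at hi2
      rw [show M + (r + e') - (M + r) = e' by omega, pow_add, ← mul_assoc,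
        Nat.mul_div_cancel _ (by positivity), ← hi2] at hj2
      exact hij (Nat.eq_of_mul_eq_mul_right (by positivity) hj2).symm
  · intro K hK K' hK' h
    simp only [Finset.coe_filter, Finset.mem_univ, true_and, Set.mem_ofPred_eq] at hK hK'
    exact eq_of_le_of_level_eq hK.1 hK'.1 h

open Classical in
theorem card_common (P Q : BiTree N) :
    (Finset.univ.filter fun R : BiTree N => P ≤ R ∧ Q ≤ R).card =
      common P.1 Q.1 * common P.2 Q.2 := by
  rw [common, common, ← Finset.card_product]
  congr 1
  ext R
  simp only [Finset.mem_filter, Finset.mem_univ, true_and, Finset.mem_product, Prod.le_def]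
  tauto

/-! ### Sums of agreement counts and of powers of two -/

/-- When `l` joins a set of size `a ≤ l`, the square grows by `2a + 1 ≤ 2l + 1`. This makes the
square linear in the indicators, so the sum over `j` can be taken first. -/
theorem sq_card_filter_le (p : ℕ → Prop) [DecidablePred p] (M : ℕ) :
    ((Finset.range M).filter p).card ^ 2 ≤
      ∑ l ∈ Finset.range M, (2 * l + 1) * (if p l then 1 else 0) := by
  induction M with
  | zero => simp
  | succ M ih =>
    have h : ((Finset.range M).filter p).card ≤ M :=
      (Finset.card_filter_le _ _).trans (Finset.card_range M).le
    rw [Finset.sum_range_succ, Finset.range_add_one, Finset.filter_insert]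
    split_ifs with hp
    · rw [Finset.card_insert_of_notMem (by simp)]
      nlinarith
    · simpa using ih

theorem sum_odd_mul_pow (M : ℕ) :
    ∑ l ∈ Finset.range M, (2 * l + 1) * 2 ^ (M - l) + (4 * M + 6) = 6 * 2 ^ M := by
  induction M with
  | zero => simp
  | succ M ih =>
    rw [Finset.sum_range_succ]
    have : ∑ l ∈ Finset.range M, (2 * l + 1) * 2 ^ (M + 1 - l) =
        2 * ∑ l ∈ Finset.range M, (2 * l + 1) * 2 ^ (M - l) := by
      rw [Finset.mul_sum]
      refine Finset.sum_congr rfl fun l hl => ?_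
      rw [Nat.succ_sub (Finset.mem_range.1 hl).le, pow_succ]
      ring
    rw [this, Nat.add_sub_cancel_left, pow_succ 2 M]
    linarith

theorem card_div_eq_le (s : Finset ℕ) {d : ℕ} (hd : 0 < d) (c : ℕ) :
    (s.filter fun j => c = j / d).card ≤ d := by
  calc _ ≤ (Finset.Ico (c * d) (c * d + d)).card := by
        refine Finset.card_le_card fun j hj => ?_
        have h := (Finset.mem_filter.1 hj).2.symm
        rw [Nat.div_eq_iff hd] at h
        rw [Finset.mem_Ico]
        omega
    _ = d := by simp

/-- At most `2^(M-l)` positions `j` share the ancestor of `i` in generation `l`, and this decay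
beats the weight `2l + 1`. -/
theorem sum_agree_sq_le (M i : ℕ) : ∑ j ∈ Finset.range (2 ^ M), agree M i j ^ 2 ≤ 6 * 2 ^ M := by
  calc ∑ j ∈ Finset.range (2 ^ M), agree M i j ^ 2
      ≤ ∑ j ∈ Finset.range (2 ^ M), ∑ l ∈ Finset.range M,
          (2 * l + 1) * (if i / 2 ^ (M - l) = j / 2 ^ (M - l) then 1 else 0) :=
        Finset.sum_le_sum fun j _ => sq_card_filter_le _ _
    _ = ∑ l ∈ Finset.range M, (2 * l + 1) *
          ((Finset.range (2 ^ M)).filter fun j => i / 2 ^ (M - l) = j / 2 ^ (M - l)).card := by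
        rw [Finset.sum_comm]
        refine Finset.sum_congr rfl fun l _ => ?_
        rw [← Finset.mul_sum, Finset.card_filter]
    _ ≤ ∑ l ∈ Finset.range M, (2 * l + 1) * 2 ^ (M - l) :=
        Finset.sum_le_sum fun l _ =>
          Nat.mul_le_mul_left _ (card_div_eq_le _ (by positivity) _)
    _ ≤ 6 * 2 ^ M := by have := sum_odd_mul_pow M; omega

theorem sum_two_pow_le {s : Finset ℕ} {φ : ℕ → ℕ} (hφ : Set.InjOn φ s) {A : ℕ}
    (h : ∀ u ∈ s, φ u < A) : ∑ u ∈ s, 2 ^ φ u ≤ 2 ^ A := by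
  classical
  rw [← Finset.sum_image (f := fun k => 2 ^ k) hφ]
  refine (Nat.geomSum_lt le_rfl ?_).le
  simpa using h

/-- The exponents are distinct on each side of `u`: below `A` for `v < u`, at most `A` for `v ≥ u`.
The condition `t ≤ A` keeps the subtraction from truncating. -/
theorem sum_two_pow_dist_le {t u A : ℕ} (hu : u ≤ t) (hA : t ≤ A) :
    ∑ v ∈ Finset.range (t + 1), 2 ^ (A - (max u v - min u v)) ≤ 3 * 2 ^ A := by
  rw [← Finset.sum_filter_add_sum_filter_not _ (fun v => v < u)]
  have h1 : ∑ v ∈ (Finset.range (t + 1)).filter (fun v => v < u),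
      2 ^ (A - (max u v - min u v)) ≤ 2 ^ A := by
    refine sum_two_pow_le (fun v hv w hw h => ?_) fun v hv => ?_
    · simp only [Finset.coe_filter, Finset.mem_range, Set.mem_ofPred_eq] at hv hw
      omega
    · simp only [Finset.mem_filter, Finset.mem_range] at hv
      omega
  have h2 : ∑ v ∈ (Finset.range (t + 1)).filter (fun v => ¬ v < u),
      2 ^ (A - (max u v - min u v)) ≤ 2 ^ (A + 1) := by
    refine sum_two_pow_le (fun v hv w hw h => ?_) fun v hv => ?_
    · simp only [Finset.coe_filter, Finset.mem_range, Set.mem_ofPred_eq] at hv hw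
      omega
    · omega
  rw [pow_succ] at h2
  linarith

/-! ### Hardy operators, superadditivity and the kernel of `𝕀𝕀*` -/

theorem rootMass_nonneg (R : BiTree N) : 0 ≤ rootMass N R := by
  unfold rootMass; split_ifs <;> norm_num

theorem nu_nonneg (s : ℕ) (R : BiTree N) : 0 ≤ nu s N R := by
  unfold nu; split_ifs <;> positivity

theorem le_root' (R : BiTree N) : R ≤ root N :=
  Prod.le_def.2 ⟨Tree.le_root _, Tree.le_root _⟩

theorem eq_root_of_le' {R : BiTree N} (h : root N ≤ R) : R = root N :=
  Prod.ext (Tree.eq_root_of_le (Prod.le_def.1 h).1) (Tree.eq_root_of_le (Prod.le_def.1 h).2)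

theorem fEx_eq (R : BiTree N) : fEx N R = rootMass N R := by
  classical
  simp only [fEx, hardyAdj, rootMass, Finset.sum_ite_eq', Finset.mem_filter, Finset.mem_univ,
    true_and]
  exact if_congr ⟨eq_root_of_le', fun h => by rw [h]; exact le_root' _⟩ rfl rfl

theorem hardy_fEx (R : BiTree N) : hardy (fEx N) R = 1 := by
  classical
  simp only [hardy, fEx_eq, rootMass, Finset.sum_ite_eq', Finset.mem_filter, Finset.mem_univ,
    true_and, le_root', if_true]

theorem sum_fEx_sq : ∑ R : BiTree N, fEx N R ^ 2 = 1 := by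
  classical
  simp [fEx_eq, rootMass, ite_pow]

theorem hardy_root (g : BiTree N → ℝ) : hardy g (root N) = g (root N) := by
  classical
  rw [hardy, Finset.sum_eq_single_of_mem (root N)
    (Finset.mem_filter.2 ⟨Finset.mem_univ _, le_root' _⟩)]
  intro R hR hne
  exact absurd (eq_root_of_le' (Finset.mem_filter.1 hR).2) hne

theorem hardyAdj_root (m : BiTree N → ℝ) : hardyAdj m (root N) = ∑ R, m R := by
  classical
  rw [hardyAdj, Finset.filter_true_of_mem fun R _ => le_root' R]

theorem hardyAdj_nonneg {m : BiTree N → ℝ} (hm : ∀ R, 0 ≤ m R) (R : BiTree N) :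
    0 ≤ hardyAdj m R :=
  Finset.sum_nonneg fun R' _ => hm R'

/-- The two halves have disjoint sets of descendants, by uniqueness of ancestors in a generation. -/
theorem superadditive_hardyAdj {m : BiTree N → ℝ} (hm : ∀ R, 0 ≤ m R) :
    Superadditive (hardyAdj m) := by
  classical
  constructor
  · intro I J
    unfold hardyAdj
    rw [← Finset.sum_biUnion]
    · refine Finset.sum_le_sum_of_subset_of_nonneg (fun R hR => ?_) fun R _ _ => hm R
      simp only [Finset.mem_biUnion, Finset.mem_filter, Finset.mem_univ, true_and,
        Prod.le_def] at hR ⊢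
      obtain ⟨I', hI', h1, h2⟩ := hR
      exact ⟨le_trans' h1 hI'.1, h2⟩
    · intro I' hI' I'' hI'' hne
      simp only [Finset.coe_filter, Finset.mem_univ, true_and, Set.mem_ofPred_eq] at hI' hI''
      refine Finset.disjoint_left.2 fun R hR hR' => hne ?_
      simp only [Finset.mem_filter, Finset.mem_univ, true_and, Prod.le_def] at hR hR'
      exact eq_of_le_of_level_eq hR.1 hR'.1 (hI'.2.trans hI''.2.symm)
  · intro I J
    unfold hardyAdj
    rw [← Finset.sum_biUnion]
    · refine Finset.sum_le_sum_of_subset_of_nonneg (fun R hR => ?_) fun R _ _ => hm R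
      simp only [Finset.mem_biUnion, Finset.mem_filter, Finset.mem_univ, true_and,
        Prod.le_def] at hR ⊢
      obtain ⟨J', hJ', h1, h2⟩ := hR
      exact ⟨h1, le_trans' h2 hJ'.1⟩
    · intro J' hJ' J'' hJ'' hne
      simp only [Finset.coe_filter, Finset.mem_univ, true_and, Set.mem_ofPred_eq] at hJ' hJ''
      refine Finset.disjoint_left.2 fun R hR hR' => hne ?_
      simp only [Finset.mem_filter, Finset.mem_univ, true_and, Prod.le_def] at hR hR'
      exact eq_of_le_of_level_eq hR.2 hR'.2 (hJ'.2.trans hJ''.2.symm)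

theorem hardy_hardyAdj (m : BiTree N → ℝ) (R : BiTree N) :
    hardy (hardyAdj m) R = ∑ R', m R' * (common R.1 R'.1 * common R.2 R'.2 : ℕ) := by
  classical
  simp only [hardy, hardyAdj, ← card_common, Finset.card_filter, Nat.cast_sum, Finset.mul_sum,
    Finset.sum_filter]
  rw [Finset.sum_comm (s := Finset.univ) (t := Finset.univ)]
  refine Finset.sum_congr rfl fun Q _ => ?_
  by_cases h : R ≤ Q
  · simp [h]
  · simp [h]

/-! ### Duality and capacity -/

/-- Duality: a family of vertices with small mutual energy has large capacity. -/
theorem sq_card_le_energy {ι : Type*} (S : Finset ι) (q : ι → BiTree N) {φ : BiTree N → ℝ}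
    (h : ∀ i ∈ S, 1 ≤ hardy φ (q i)) :
    (S.card : ℝ) ^ 2 ≤ (∑ R, φ R ^ 2) *
      (∑ i ∈ S, ∑ i' ∈ S, common (q i).1 (q i').1 * common (q i).2 (q i').2 : ℕ) := by
  classical
  -- This is `𝕀*` of the counting measure of the family: its pairing with `φ` is the integral of
  -- `𝕀φ`, its square sum is the energy.
  set m : BiTree N → ℝ := fun R => ∑ i ∈ S, if q i ≤ R then 1 else 0 with hm
  have h1 : (S.card : ℝ) ≤ ∑ R, φ R * m R := by
    calc (S.card : ℝ) = ∑ i ∈ S, 1 := by simp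
      _ ≤ ∑ i ∈ S, hardy φ (q i) := Finset.sum_le_sum h
      _ = ∑ R, φ R * m R := by
        simp only [hardy, hm, Finset.mul_sum, Finset.sum_filter, mul_ite, mul_one, mul_zero]
        rw [Finset.sum_comm]
  have h2 : ∑ R, m R ^ 2 =
      (∑ i ∈ S, ∑ i' ∈ S, common (q i).1 (q i').1 * common (q i).2 (q i').2 : ℕ) := by
    simp only [← card_common, Finset.card_filter, Nat.cast_sum, hm, sq, Finset.sum_mul_sum]
    rw [Finset.sum_comm]
    refine Finset.sum_congr rfl fun i _ => ?_
    rw [Finset.sum_comm]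
    refine Finset.sum_congr rfl fun i' _ => Finset.sum_congr rfl fun R _ => ?_
    by_cases h1 : q i ≤ R <;> by_cases h2 : q i' ≤ R <;> simp [h1, h2]
  rw [← h2]
  refine le_trans ?_ (Finset.sum_mul_sq_le_sq_mul_sq Finset.univ φ m)
  gcongr

theorem capacity_le {E : Set (BiTree N)} {φ : BiTree N → ℝ} (h0 : ∀ R, 0 ≤ φ R)
    (h1 : ∀ R ∈ E, 1 ≤ hardy φ R) : capacity E ≤ ∑ R, φ R ^ 2 := by
  refine csInf_le ⟨0, ?_⟩ ⟨φ, h0, h1, rfl⟩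
  rintro x ⟨f, -, -, rfl⟩
  positivity

theorem capacity_le_one (E : Set (BiTree N)) : capacity E ≤ 1 := by
  rw [← sum_fEx_sq (N := N)]
  exact capacity_le (fun R => fEx_eq R ▸ rootMass_nonneg R) fun R _ => (hardy_fEx R).ge

theorem le_capacity {E : Set (BiTree N)} {c : ℝ}
    (h : ∀ φ : BiTree N → ℝ, (∀ R ∈ E, 1 ≤ hardy φ R) → c ≤ ∑ R, φ R ^ 2) : c ≤ capacity E := by
  -- Nonemptiness matters, as `sInf ∅ = 0`; `fEx N` is admissible for every set.
  refine le_csInf ⟨_, fEx N, fun R => fEx_eq R ▸ rootMass_nonneg R,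
    fun R _ => (hardy_fEx R).ge, rfl⟩ ?_
  rintro x ⟨f, -, hf, rfl⟩
  exact h f hf

/-! ### Parameters, the measure `ν` and the kernel bound -/

theorem logn_eq {s : ℕ} (hs : 2 ≤ s) : logn s = 4 * 2 ^ (s - 2) := by
  obtain ⟨r, rfl⟩ := Nat.exists_eq_add_of_le hs
  rw [logn, pow_add, Nat.add_sub_cancel_left]; norm_num

theorem two_pow_MM_mul (s : ℕ) : 2 ^ MM s * logn s = nn s := by
  have h : s ≤ logn s := Nat.lt_two_pow_self.le
  calc 2 ^ MM s * logn s = 2 ^ (logn s - s) * 2 ^ s := rfl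
    _ = nn s := by rw [← pow_add, Nat.sub_add_cancel h, nn]

theorem sum_nu_mul {s : ℕ} (hN : MM s + nn s ≤ N) (F : BiTree N → ℝ) :
    ∑ R, nu s N R * F R = ∑ j ∈ Finset.range (2 ^ MM s), 1 / (nn s : ℝ) ^ 2 *
      F (corner N (MM s) (nn s) j, corner N (MM s) (nn s) j) := by
  classical
  have hinj : Set.InjOn (fun j => ((corner N (MM s) (nn s) j, corner N (MM s) (nn s) j) :
      BiTree N)) (Finset.range (2 ^ MM s)) := by
    intro i hi j hj h
    simp only [Finset.coe_range, Set.mem_Iio] at hi hj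
    have h1 := (corner_is hN hi).2
    rw [show corner N (MM s) (nn s) i = corner N (MM s) (nn s) j from congrArg Prod.fst h,
      (corner_is hN hj).2] at h1
    exact (Nat.eq_of_mul_eq_mul_right (by positivity) h1).symm
  rw [← Finset.sum_image (f := fun R => 1 / (nn s : ℝ) ^ 2 * F R) hinj]
  rw [← Finset.sum_subset (Finset.subset_univ (Finset.image _ _))]
  · refine Finset.sum_congr rfl fun R hR => ?_
    obtain ⟨j, hj, rfl⟩ := Finset.mem_image.1 hR
    have hj' := Finset.mem_range.1 hj
    rw [nu, if_pos ⟨j, hj', corner_is hN hj', corner_is hN hj'⟩]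
  · intro R _ hR
    rw [nu, if_neg, zero_mul]
    rintro ⟨j, hj, h1, h2⟩
    exact hR (Finset.mem_image.2 ⟨j, Finset.mem_range.2 hj,
      Prod.ext ((corner_is hN hj).eq h1) ((corner_is hN hj).eq h2)⟩)

theorem sum_nu {s : ℕ} (hN : MM s + nn s ≤ N) : ∑ R, nu s N R = delta s := by
  have h := sum_nu_mul hN (fun _ => 1)
  simp only [mul_one, Finset.sum_const, Finset.card_range, nsmul_eq_mul] at h
  rw [h, delta, ← two_pow_MM_mul]
  have : (logn s : ℝ) ≠ 0 := by simp [logn]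
  push_cast
  field_simp

/-- The product of the numbers of common ancestors in the two coordinates, for vertices in the
corner of the same diagonal square. -/
theorem mul_add_one_le {t M u v : ℕ} (ht : 1 ≤ t) (hM : M + 1 ≤ 4 * t) (hvu : v ≤ u) (hu : u ≤ t) :
    (M + 2 ^ (2 * t - u) + 1) * (M + 2 ^ (2 * t + v) + 1) ≤
      2 ^ (4 * t - (u - v)) + 12 * t * 2 ^ (3 * t) := by
  have h1 : 2 ^ (2 * t - u) * 2 ^ (2 * t + v) = 2 ^ (4 * t - (u - v)) := by
    rw [← pow_add]; congr 1; omega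
  have h2 : 2 ^ (2 * t - u) ≤ 2 ^ (3 * t) := Nat.pow_le_pow_right (by norm_num) (by omega)
  have h3 : 2 ^ (2 * t + v) ≤ 2 ^ (3 * t) := Nat.pow_le_pow_right (by norm_num) (by omega)
  have h4 : M + 1 ≤ 2 ^ (3 * t) := by
    refine hM.trans ?_
    rw [show 3 * t = t + 2 * t by ring, pow_add, pow_mul]
    have h5 : t < 2 ^ t := Nat.lt_two_pow_self
    have h6 : 4 ^ 1 ≤ 4 ^ t := Nat.pow_le_pow_right (by norm_num) ht
    norm_num
    nlinarith
  calc (M + 2 ^ (2 * t - u) + 1) * (M + 2 ^ (2 * t + v) + 1)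
      = 2 ^ (2 * t - u) * 2 ^ (2 * t + v) +
        (M + 1) * (2 ^ (2 * t - u) + 2 ^ (2 * t + v) + (M + 1)) := by ring
    _ ≤ 2 ^ (4 * t - (u - v)) + (4 * t) * (2 ^ (3 * t) + 2 ^ (3 * t) + 2 ^ (3 * t)) := by
        rw [h1]; gcongr
    _ = _ := by ring

theorem mul_sq_le_two_pow {t : ℕ} (ht : 16 ≤ t) : 48 * t ^ 2 ≤ 2 ^ t := by
  induction t, ht using Nat.le_induction with
  | base => norm_num
  | succ t ht ih =>
    rw [pow_succ 2 t]
    nlinarith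

/-- In the same diagonal square, the shallower generation limits each count; in different squares,
`agree` does. Keeping the `agree` term also for `i = j` lets it be summed over all `j`. -/
theorem common_mul_common_le {M d e d' e' i j B : ℕ} {R R' : BiTree N}
    (h1 : R.1.Is (M + d) (i * 2 ^ d)) (h2 : R.2.Is (M + e) (i * 2 ^ e))
    (h1' : R'.1.Is (M + d') (j * 2 ^ d')) (h2' : R'.2.Is (M + e') (j * 2 ^ e'))
    (hB : (M + min d d' + 1) * (M + min e e' + 1) ≤ B) :
    common R.1 R'.1 * common R.2 R'.2 ≤ (if i = j then B else 0) + agree M i j ^ 2 := by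
  split_ifs with h
  · refine le_add_right (le_trans (Nat.mul_le_mul ?_ ?_) hB)
    · have := common_le_left R.1 R'.1
      have := common_le_right R.1 R'.1
      rw [h1.1] at *
      rw [h1'.1] at *
      omega
    · have := common_le_left R.2 R'.2
      have := common_le_right R.2 R'.2
      rw [h2.1] at *
      rw [h2'.1] at *
      omega
  · rw [zero_add, sq]
    exact Nat.mul_le_mul (common_le_agree h1 h1' h) (common_le_agree h2 h2' h)

/-- Numerical data of the construction in terms of `t = (log n) / 4`. -/
theorem parameters {s : ℕ} (hs : 6 ≤ s) : ∃ t : ℕ, 16 ≤ t ∧ logn s = 4 * t ∧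
    nn s = 2 ^ (4 * t) ∧ 2 ^ MM s * (4 * t) = 2 ^ (4 * t) ∧ MM s + 1 ≤ 4 * t := by
  have h := logn_eq (show 2 ≤ s by omega)
  have h2 := two_pow_MM_mul s
  rw [nn, h] at h2
  refine ⟨2 ^ (s - 2), ?_, h, by rw [nn, h], h2, ?_⟩
  · calc 16 = 2 ^ 4 := by norm_num
      _ ≤ 2 ^ (s - 2) := Nat.pow_le_pow_right (by norm_num) (by omega)
  · rw [← h, MM]
    have : s < logn s := Nat.lt_two_pow_self
    omega

theorem pow_div_pow {t k : ℕ} (h : k ≤ 4 * t) : 2 ^ (4 * t) / 2 ^ k = 2 ^ (4 * t - k) :=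
  Nat.pow_div h (by norm_num)

/-! ### Energy of the rectangles and capacity of `F` -/

/-- The rectangle `q_{jk}` with `k = 2 t + u`, where `4 t = log n`. -/
noncomputable def rect (N M t j u : ℕ) : BiTree N :=
  (corner N M (2 ^ (2 * t - u)) j, corner N M (2 ^ (2 * t + u)) j)

theorem sub_bounds {t u n : ℕ} (hu : u ≤ t) (hn : n = 2 ^ (4 * t)) :
    2 ^ (2 * t - u) ≤ n ∧ 2 ^ (2 * t + u) ≤ n := by
  subst hn
  exact ⟨Nat.pow_le_pow_right (by norm_num) (by omega),
    Nat.pow_le_pow_right (by norm_num) (by omega)⟩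

theorem rect_mem_setF {s t j u : ℕ} (hL : logn s = 4 * t) (hn : nn s = 2 ^ (4 * t))
    (hN : MM s + nn s ≤ N) (hj : j < 2 ^ MM s) (hu : u ≤ t) :
    rect N (MM s) t j u ∈ setF s N := by
  obtain ⟨h1, h2⟩ := sub_bounds hu hn
  refine ⟨j, 2 * t + u, hj, by omega, by omega, ?_⟩
  rw [IsQ, hn, pow_div_pow (by omega), show 4 * t - (2 * t + u) = 2 * t - u by omega]
  exact ⟨corner_is (by omega) hj, corner_is (by omega) hj⟩

theorem energy_rect_le {M t : ℕ} (ht : 16 ≤ t) (hMt : 2 ^ M * (4 * t) = 2 ^ (4 * t))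
    (hM : M + 1 ≤ 4 * t) (hN : M + 2 ^ (4 * t) ≤ N) :
    ∑ p ∈ Finset.range (2 ^ M) ×ˢ Finset.range (t + 1),
      ∑ p' ∈ Finset.range (2 ^ M) ×ˢ Finset.range (t + 1),
        common (rect N M t p.1 p.2).1 (rect N M t p'.1 p'.2).1 *
          common (rect N M t p.1 p.2).2 (rect N M t p'.1 p'.2).2 ≤
      19 * (2 ^ M * (t + 1)) ^ 2 := by
  have key : ∀ p ∈ Finset.range (2 ^ M) ×ˢ Finset.range (t + 1),
      ∑ p' ∈ Finset.range (2 ^ M) ×ˢ Finset.range (t + 1),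
        common (rect N M t p.1 p.2).1 (rect N M t p'.1 p'.2).1 *
          common (rect N M t p.1 p.2).2 (rect N M t p'.1 p'.2).2 ≤
      3 * 2 ^ (4 * t) + (t + 1) * (12 * t * 2 ^ (3 * t)) + (t + 1) * (6 * 2 ^ M) := by
    rintro ⟨i, u⟩ hp
    simp only [Finset.mem_product, Finset.mem_range, Nat.lt_succ_iff] at hp
    obtain ⟨hi, hu⟩ := hp
    calc _ ≤ ∑ p' ∈ Finset.range (2 ^ M) ×ˢ Finset.range (t + 1),
          ((if i = p'.1 then 2 ^ (4 * t - (max u p'.2 - min u p'.2)) + 12 * t * 2 ^ (3 * t) else 0)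
            + agree M i p'.1 ^ 2) := by
          refine Finset.sum_le_sum ?_
          rintro ⟨j, v⟩ hp'
          simp only [Finset.mem_product, Finset.mem_range, Nat.lt_succ_iff] at hp'
          obtain ⟨hj, hv⟩ := hp'
          obtain ⟨hu1, hu2⟩ := sub_bounds hu rfl
          obtain ⟨hv1, hv2⟩ := sub_bounds hv rfl
          refine common_mul_common_le (corner_is (le_trans (by gcongr) hN) hi)
            (corner_is (le_trans (by gcongr) hN) hi) (corner_is (le_trans (by gcongr) hN) hj)
            (corner_is (le_trans (by gcongr) hN) hj) ?_
          -- The horizontal depth `2^(2t-u)` decreases in `u` and the vertical depth `2^(2t+u)`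
          -- increases, so the shallower ones belong to `max u v` and `min u v` respectively.
          have := mul_add_one_le (by omega) hM (min_le_max (a := u) (b := v)) (max_le hu hv)
          refine le_trans (Nat.mul_le_mul ?_ ?_) this
          · rcases le_total u v with h | h
            · rw [max_eq_right h]
              gcongr
              exact min_le_right _ _
            · rw [max_eq_left h]
              gcongr
              exact min_le_left _ _
          · rcases le_total u v with h | h
            · rw [min_eq_left h]
              gcongr
              exact min_le_left _ _
            · rw [min_eq_right h]
              gcongr
              exact min_le_right _ _
      _ = ∑ v ∈ Finset.range (t + 1),
            (2 ^ (4 * t - (max u v - min u v)) + 12 * t * 2 ^ (3 * t)) +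
          ∑ v ∈ Finset.range (t + 1), ∑ j ∈ Finset.range (2 ^ M), agree M i j ^ 2 := by
          rw [Finset.sum_add_distrib, Finset.sum_product_right, Finset.sum_product_right]
          simp [hi]
      _ ≤ _ := by
          rw [Finset.sum_add_distrib]
          refine add_le_add (add_le_add (sum_two_pow_dist_le hu (by omega)) (by simp)) ?_
          refine (Finset.sum_le_sum fun v _ => sum_agree_sq_le M i).trans (by simp)
  refine (Finset.sum_le_sum key).trans ?_
  simp only [Finset.sum_const, Finset.card_product, Finset.card_range, smul_eq_mul]
  -- Multiplied by `4t`, this is `48 t² ≤ 2^t`, the reason for `t ≥ 16`.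
  have h1 : 12 * t * 2 ^ (3 * t) ≤ 2 ^ M := by
    have h2 := mul_sq_le_two_pow ht
    refine Nat.le_of_mul_le_mul_right (c := 4 * t) ?_ (by omega)
    rw [hMt, show 4 * t = t + 3 * t by ring, pow_add 2 t]
    calc 12 * t * 2 ^ (3 * t) * (t + 3 * t) = 48 * t ^ 2 * 2 ^ (3 * t) := by ring
      _ ≤ _ := Nat.mul_le_mul_right _ h2
  rw [sq (2 ^ M * (t + 1)), ← hMt]
  -- `19 = 12 + 1 + 6`: main term, error in the same square, other squares.
  calc 2 ^ M * (t + 1) * (3 * (2 ^ M * (4 * t)) + (t + 1) * (12 * t * 2 ^ (3 * t)) +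
        (t + 1) * (6 * 2 ^ M))
      ≤ 2 ^ M * (t + 1) * (3 * (2 ^ M * (4 * (t + 1))) + (t + 1) * 2 ^ M +
        (t + 1) * (6 * 2 ^ M)) := by gcongr; omega
    _ = _ := by ring

theorem le_capacity_setF {s : ℕ} (hs : 6 ≤ s) (hN : MM s + nn s ≤ N) :
    1 / 19 ≤ capacity (setF s N) := by
  obtain ⟨t, ht, hL, hn, hMt, hM⟩ := parameters hs
  refine le_capacity fun φ hφ => ?_
  have h := sq_card_le_energy (Finset.range (2 ^ MM s) ×ˢ Finset.range (t + 1))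
    (fun p => rect N (MM s) t p.1 p.2) (φ := φ) fun p hp => by
      simp only [Finset.mem_product, Finset.mem_range, Nat.lt_succ_iff] at hp
      exact hφ _ (rect_mem_setF hL hn hN hp.1 hp.2)
  have h2 := energy_rect_le (N := N) ht hMt hM (hn ▸ hN)
  have h0 : 0 ≤ ∑ R, φ R ^ 2 := Finset.sum_nonneg fun R _ => sq_nonneg _
  have h3 := h.trans (mul_le_mul_of_nonneg_left (Nat.cast_le.2 h2) h0)
  rw [Finset.card_product, Finset.card_range, Finset.card_range, Nat.cast_mul 19, Nat.cast_pow _ 2]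
    at h3
  have h4 : (0 : ℝ) < ((2 ^ MM s * (t + 1) : ℕ) : ℝ) ^ 2 := by positivity
  push_cast at h3 h4
  rw [div_le_iff₀ (by norm_num)]
  refine le_of_mul_le_mul_right ?_ h4
  linarith

/-! ### The potential of `ν` on `F` -/

theorem hardy_gEx_bounds {s : ℕ} (hs : 6 ≤ s) (hN : MM s + nn s ≤ N) {R : BiTree N}
    (hR : R ∈ setF s N) :
    1 / (nn s : ℝ) ≤ hardy (gEx s N) R ∧ hardy (gEx s N) R ≤ 2 / nn s := by
  obtain ⟨t, ht, hL, hn, hMt, hM⟩ := parameters hs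
  obtain ⟨i, k, hi, hk1, hk2, hq⟩ := hR
  obtain ⟨u, rfl⟩ := Nat.exists_eq_add_of_le (show 2 * t ≤ k by omega)
  have hu : u ≤ t := by omega
  obtain ⟨hu1, hu2⟩ := sub_bounds hu hn
  obtain ⟨hq1, hq2⟩ := hq
  rw [show nn s / 2 ^ (2 * t + u) = 2 ^ (2 * t - u) by
    rw [hn, pow_div_pow (by omega)]; congr 1; omega] at hq1
  have hn0 : (0 : ℝ) < nn s := by rw [hn]; positivity
  set c := fun j => common R.1 (corner N (MM s) (nn s) j) * common R.2 (corner N (MM s) (nn s) j)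
    with hc
  have hsum : hardy (gEx s N) R =
      1 / (nn s : ℝ) ^ 2 * ((∑ j ∈ Finset.range (2 ^ MM s), c j : ℕ) : ℝ) := by
    rw [gEx, hardy_hardyAdj, sum_nu_mul hN, Nat.cast_sum, Finset.mul_sum]
  -- The term `j = i` suffices: `ω_i` lies in the rectangle, so every ancestor of the rectangle is
  -- common to both.
  have hlow : nn s ≤ ∑ j ∈ Finset.range (2 ^ MM s), c j := by
    refine le_trans ?_ (Finset.single_le_sum (fun j _ => Nat.zero_le (c j))
      (Finset.mem_range.2 hi))
    have h1 := level_lt_common (hq1.le (corner_is hN hi) hu1)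
    have h2 := level_lt_common (hq2.le (corner_is hN hi) hu2)
    rw [hq1.1] at h1
    rw [hq2.1] at h2
    calc nn s = 2 ^ (2 * t - u) * 2 ^ (2 * t + u) := by
          rw [hn, ← pow_add]; congr 1; omega
      _ ≤ c i := Nat.mul_le_mul (by omega) (by omega)
  have hup : ∑ j ∈ Finset.range (2 ^ MM s), c j ≤ 2 * nn s := by
    calc ∑ j ∈ Finset.range (2 ^ MM s), c j
        ≤ ∑ j ∈ Finset.range (2 ^ MM s),
          ((if i = j then 2 ^ (4 * t) + 12 * t * 2 ^ (3 * t) else 0) + agree (MM s) i j ^ 2) := by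
          refine Finset.sum_le_sum fun j hj => ?_
          have hj := Finset.mem_range.1 hj
          refine common_mul_common_le (R' := (corner N (MM s) (nn s) j,
            corner N (MM s) (nn s) j)) hq1 hq2 (corner_is hN hj) (corner_is hN hj) ?_
          rw [min_eq_left hu1, min_eq_left hu2]
          simpa using mul_add_one_le (by omega) hM le_rfl hu
      _ ≤ 2 ^ (4 * t) + 12 * t * 2 ^ (3 * t) + 6 * 2 ^ MM s := by
          rw [Finset.sum_add_distrib, Finset.sum_ite_eq, if_pos (Finset.mem_range.2 hi)]
          exact Nat.add_le_add_left (sum_agree_sq_le _ _) _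
      _ ≤ 2 * nn s := by
          have h1 := Nat.mul_le_mul_right (2 ^ (3 * t)) (mul_sq_le_two_pow ht)
          rw [← pow_add, show t + 3 * t = 4 * t by ring] at h1
          have h2 : 16 * (12 * t * 2 ^ (3 * t)) ≤ t * (12 * t * 2 ^ (3 * t)) :=
            Nat.mul_le_mul_right _ ht
          have h3 : 16 * 2 ^ MM s ≤ t * 2 ^ MM s := Nat.mul_le_mul_right _ ht
          rw [hn]
          nlinarith
  rw [hsum]
  have h1 : (nn s : ℝ) ≤ ((∑ j ∈ Finset.range (2 ^ MM s), c j : ℕ) : ℝ) := Nat.cast_le.2 hlow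
  have h2 : ((∑ j ∈ Finset.range (2 ^ MM s), c j : ℕ) : ℝ) ≤ 2 * nn s := by
    exact_mod_cast hup
  constructor
  · calc 1 / (nn s : ℝ) = 1 / (nn s : ℝ) ^ 2 * nn s := by field_simp
      _ ≤ _ := by gcongr
  · calc _ ≤ 1 / (nn s : ℝ) ^ 2 * (2 * nn s) := by gcongr
      _ = 2 / nn s := by field_simp

/-! ### Contradiction with majorization -/

theorem delta_div {s : ℕ} : delta s / (1 / 2 / nn s) = 2 / logn s := by
  have h1 : (nn s : ℝ) ≠ 0 := by simp [nn]
  have h2 : (logn s : ℝ) ≠ 0 := by simp [logn]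
  rw [delta]
  field_simp

theorem tendsto_two_div_logn : Tendsto (fun s => 2 / (logn s : ℝ)) atTop (𝓝[>] 0) := by
  refine tendsto_nhdsWithin_iff.2 ⟨?_, Eventually.of_forall fun s => ?_⟩
  · refine Tendsto.div_atTop tendsto_const_nhds ?_
    simp only [logn, Nat.cast_pow, Nat.cast_ofNat]
    exact tendsto_pow_atTop_atTop_of_one_lt (by norm_num)
  · have : 0 < logn s := by rw [logn]; positivity
    have : (0 : ℝ) < logn s := Nat.cast_pos.2 this
    exact div_pos two_pos this

theorem level_set_bounds {s : ℕ} (hs : 6 ≤ s) (hN : MM s + nn s ≤ N) {R : BiTree N}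
    (hR : R ∈ setF s N) : 2 * (1 / 2 / (nn s : ℝ)) ≤ hardy (gEx s N) R ∧
      hardy (gEx s N) R ≤ 4 * (1 / 2 / nn s) := by
  have h := hardy_gEx_bounds hs hN hR
  rw [show 2 * (1 / 2 / (nn s : ℝ)) = 1 / nn s by ring,
    show 4 * (1 / 2 / (nn s : ℝ)) = 2 / nn s by ring]
  exact h

theorem IsMajorant.capacity_le {s : ℕ} (hs : 6 ≤ s) (hN : MM s + nn s ≤ N) {B : ℝ}
    {φ : BiTree N → ℝ} (h : IsMajorant (fEx N) (gEx s N) (1 / 2 / nn s) B φ) :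
    capacity (setF s N) ≤ B := by
  obtain ⟨h0, h1, h2⟩ := h
  rw [sum_fEx_sq, mul_one] at h2
  refine (DyadicBiTree.capacity_le h0 fun R hR => ?_).trans h2
  obtain ⟨h3, h4⟩ := level_set_bounds hs hN hR
  exact hardy_fEx R ▸ h1 R h3 h4

theorem eventually_no_majorant {h : ℝ → ℝ} (hh : Tendsto h (𝓝[>] 0) (𝓝 0)) (C : ℝ) :
    ∃ s₁ : ℕ, ∀ s ≥ s₁, ∀ N ≥ MM s + nn s, ¬ ∃ φ : BiTree N → ℝ,
      IsMajorant (fEx N) (gEx s N) (1 / 2 / nn s) (C * h (delta s / (1 / 2 / nn s))) φ := by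
  have h1 : Tendsto (fun s => C * h (2 / logn s)) atTop (𝓝 (C * 0)) :=
    (hh.comp tendsto_two_div_logn).const_mul C
  rw [mul_zero] at h1
  obtain ⟨s₁, hs₁⟩ := eventually_atTop.1
    (h1.eventually_lt_const (show (0 : ℝ) < 1 / 19 by norm_num))
  refine ⟨max s₁ 6, fun s hs N hN => ?_⟩
  rintro ⟨φ, hφ⟩
  have h2 := hφ.capacity_le (le_of_max_le_right hs) hN
  have h3 := le_capacity_setF (le_of_max_le_right hs) hN
  have h4 := hs₁ s (le_of_max_le_left hs)
  rw [delta_div] at h2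
  linarith

theorem ten_mul_delta_le {s : ℕ} (hs : 6 ≤ s) : 10 * delta s ≤ 1 / 2 / nn s := by
  obtain ⟨t, ht, hL, hn, -, -⟩ := parameters hs
  have h1 : (0 : ℝ) < nn s := by rw [hn]; positivity
  have h2 : (64 : ℝ) ≤ logn s := by rw [hL]; exact_mod_cast (by omega : 64 ≤ 4 * t)
  rw [delta, div_div, mul_one_div, div_le_div_iff₀ (by positivity) (by positivity)]
  nlinarith

theorem gEx_root {s : ℕ} (hN : MM s + nn s ≤ N) : gEx s N (root N) = delta s := by
  rw [gEx, hardyAdj_root, sum_nu hN]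

theorem hardy_gEx_le_of_mem_support {s : ℕ} (hN : MM s + nn s ≤ N) {R : BiTree N}
    (hR : fEx N R ≠ 0) : hardy (gEx s N) R ≤ delta s := by
  classical
  rw [fEx_eq, rootMass, ne_eq, ite_eq_right_iff, not_forall] at hR
  obtain ⟨rfl, -⟩ := hR
  rw [hardy_root, gEx_root hN]

theorem not_smallEnergyMajorization {h : ℝ → ℝ} (hh : Tendsto h (𝓝[>] 0) (𝓝 0)) :
    ¬ ∃ C : ℝ, SmallEnergyMajorization h C := by
  rintro ⟨C, hC⟩
  obtain ⟨s₁, hs₁⟩ := eventually_no_majorant hh C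
  refine hs₁ (max s₁ 6) (le_max_left _ _) _ le_rfl
    (hC _ (fEx _) (gEx (max s₁ 6) _) (hardyAdj_nonneg rootMass_nonneg)
      (hardyAdj_nonneg (nu_nonneg _)) (superadditive_hardyAdj (nu_nonneg _)) _ _ ?_
      (fun R hR => hardy_gEx_le_of_mem_support le_rfl hR) (ten_mul_delta_le (le_max_right _ _)))
  rw [delta, nn, logn]
  positivity

end DyadicBiTree

theorem mainTheorem1 :
    -- the construction, with `lam = c / n`
    (∃ c > (0 : ℝ), ∃ c₀ > (0 : ℝ), ∃ s₀ : ℕ,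
      (∀ s ≥ s₀, ∀ N ≥ MM s + nn s,
        (fEx N (root N) = 1 ∧ (∀ R, R ≠ root N → fEx N R = 0) ∧ ∀ R, hardy (fEx N) R = 1) ∧
        ((∀ R, 0 ≤ gEx s N R) ∧ Superadditive (gEx s N) ∧
          ∑ R, nu s N R = delta s ∧ gEx s N (root N) = delta s) ∧
        (∀ R, fEx N R ≠ 0 → hardy (gEx s N) R ≤ delta s) ∧
        10 * delta s ≤ c / nn s ∧
        (∀ R ∈ setF s N,
          2 * (c / nn s) ≤ hardy (gEx s N) R ∧ hardy (gEx s N) R ≤ 4 * (c / nn s)) ∧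
        (c₀ ≤ capacity (setF s N) ∧ capacity (setF s N) ≤ 1) ∧
        -- a majorant with constant `C` would force `cap F ≤ (C / c) / log n`
        (∀ (C : ℝ) (φ : BiTree N → ℝ),
          IsMajorant (fEx N) (gEx s N) (c / nn s) (C * (delta s / (c / nn s))) φ →
            capacity (setF s N) ≤ C / c / logn s)) ∧
      -- the same functions rule out every rate `h`
      (∀ h : ℝ → ℝ, Tendsto h (𝓝[>] 0) (𝓝 0) → ∀ C : ℝ, ∃ s₁ : ℕ, ∀ s ≥ s₁, ∀ N ≥ MM s + nn s,
        ¬ ∃ φ : BiTree N → ℝ,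
          IsMajorant (fEx N) (gEx s N) (c / nn s) (C * h (delta s / (c / nn s))) φ)) ∧
    -- the conjecture is false, and so are its weakenings
    (¬ ∃ C : ℝ, SmallEnergyMajorization (fun t => t) C) ∧
    (∀ ε > (0 : ℝ), ¬ ∃ C : ℝ, SmallEnergyMajorization (fun t => t ^ ε) C) ∧
    (∀ h : ℝ → ℝ, Tendsto h (𝓝[>] 0) (𝓝 0) → ¬ ∃ C : ℝ, SmallEnergyMajorization h C) := by
  -- `c = 1/2` turns the bounds `1/n ≤ 𝕀g ≤ 2/n` into `2λ ≤ 𝕀g ≤ 4λ`; `s ≥ 6` gives `t = 2^(s-2) ≥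
  -- 16`.
  refine ⟨⟨1 / 2, by norm_num, 1 / 19, by norm_num, 6, fun s hs N hN => ⟨⟨?_, ?_, hardy_fEx⟩,
    ⟨hardyAdj_nonneg (nu_nonneg s), superadditive_hardyAdj (nu_nonneg s), sum_nu hN, gEx_root hN⟩,
    fun R hR => hardy_gEx_le_of_mem_support hN hR, ten_mul_delta_le hs,
    fun R hR => level_set_bounds hs hN hR, ⟨le_capacity_setF hs hN, capacity_le_one _⟩,
    fun C φ hφ => ?_⟩, fun h hh C => eventually_no_majorant hh C⟩,
    not_smallEnergyMajorization (tendsto_id.mono_left nhdsWithin_le_nhds),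
    fun ε hε => not_smallEnergyMajorization ?_, fun h hh => not_smallEnergyMajorization hh⟩
  · rw [fEx_eq, rootMass, if_pos rfl]
  · intro R hR
    rw [fEx_eq, rootMass, if_neg hR]
  · refine (hφ.capacity_le hs hN).trans_eq ?_
    rw [delta_div]
    ring
  · have h := (Real.continuousAt_rpow_const (0 : ℝ) ε (Or.inr hε.le)).tendsto
    rw [Real.zero_rpow hε.ne'] at h
    exact h.mono_left nhdsWithin_le_nhds
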